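/- Let $\mathbb F$ be a field of characteristic different from $2$ and $3$ over which every polynomial of degree $2$ or $3$ has a root. A two-dimensional algebra $\mathbb A$ over $\mathbb F$ is a two-dimensional $\mathbb F$-vector space with a bilinear product (not assumed associative, commutative or unital); it is nontrivial if the product is not identically zero, and $\mathbb A^{op}$ is the same space with the product $u*v=v\cdot u$. A matrix $$\begin{pmatrix}\alpha_1&\alpha_2&\alpha_3&\alpha_4\\ \beta_1&\beta_2&\beta_3&\beta_4\end{pmatrix}$$ denotes the algebra on $\mathbb F^2$ with $e_1e_1=\alpha_1e_1+\beta_1e_2$, $e_1e_2=\alpha_2e_1+\beta_2e_2$, $e_2e_1=\alpha_3e_1+\beta_3e_2$, $e_2e_2=\alpha_4e_1+\beta_4e_2$. Put $$A_1(\alpha_1,\alpha_2,\alpha_4,\beta_1)=\begin{pmatrix}\alpha_1&\alpha_2&\alpha_2+1&\alpha_4\\ \beta_1&-\alpha_1&-\alpha_1+1&-\alpha_2\end{pmatrix},\quad A_2(\alpha_1,\beta_1,\beta_2)=\begin{pmatrix}\alpha_1&0&0&1\\ \beta_1&\beta_2&1-\alpha_1&0\end{pmatrix},$$ $$A_3(\beta_1,\beta_2)=\begin{pmatrix}0&1&1&0\\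 \beta_1&\beta_2&1&-1\end{pmatrix},\quad A_4(\alpha_1,\beta_2)=\begin{pmatrix}\alpha_1&0&0&0\\ 0&\beta_2&1-\alpha_1&0\end{pmatrix},\quad A_5(\alpha_1)=\begin{pmatrix}\alpha_1&0&0&0\\ 1&2\alpha_1-1&1-\alpha_1&0\end{pmatrix},$$ $$A_{10}=\begin{pmatrix}0&1&1&0\\ 0&0&0&-1\end{pmatrix},\quad A_{11}=\begin{pmatrix}0&1&1&0\\ 1&0&0&-1\end{pmatrix},\quad A_{12}=\begin{pmatrix}0&0&0&0\\ 1&0&0&0\end{pmatrix}.$$ Then a two-dimensional algebra $\mathbb A$ over $\mathbb F$ is nontrivial and satisfies $\mathbb A^{op}\cong\mathbb A$ if and only if it is isomorphic to one of the algebras $$A_1(\alpha_1,-\alpha_1,\alpha_2,\alpha_2),\ A_2(\alpha_1,\beta_1,1-\alpha_1),\ A_2(0,0,-1),\ A_3(\beta_1,1),\ A_3(\beta_1,-1),\ A_4(\alpha_1,1-\alpha_1),$$ $$A_4(0,-1),\ A_5\left(\tfrac23\right),\ A_5(0),\ A_{10},\ A_{11},\ A_{12},$$ where $\alpha_1,\alpha_2,\beta_1$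 are arbitrary elements of $\mathbb F$. Moreover, two algebras on this list given by different matrices are isomorphic if and only if they are $A_2(\alpha_1,\beta_1,1-\alpha_1)$ and $A_2(\alpha_1,-\beta_1,1-\alpha_1)$ for some $\alpha_1,\beta_1\in\mathbb F$. -/

import Mathlib

namespace TwoDimAlg

/-- An algebra over `F` is a vector space `A` with a bilinear product `A →ₗ[F] A →ₗ[F] A`.
Two algebras are isomorphic if some linear equivalence respects the products.
The opposite of the algebra with product `μ` has product `μ.flip`, i.e. `u * v = v · u`. -/
def AlgIso {F A B : Type*} [Field F] [AddCommGroup A] [Module F A] [AddCommGroup B] [Module F B]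
    (μ : A →ₗ[F] A →ₗ[F] A) (ν : B →ₗ[F] B →ₗ[F] B) : Prop :=
  ∃ f : A ≃ₗ[F] B, ∀ u v : A, f (μ u v) = ν (f u) (f v)

/-- The algebra on `F²` with matrix of structure constants `M`. The columns of `M` are the
coordinates of `e₁e₁`, `e₁e₂`, `e₂e₁`, `e₂e₂`, in this order. -/
def ofMSC {F : Type*} [Field F] (M : Matrix (Fin 2) (Fin 4) F) :
    (Fin 2 → F) →ₗ[F] (Fin 2 → F) →ₗ[F] (Fin 2 → F) :=
  LinearMap.mk₂ F
    (fun u v i => M i 0 * (u 0 * v 0) + M i 1 * (u 0 * v 1) + M i 2 * (u 1 * v 0)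
      + M i 3 * (u 1 * v 1))
    (by intro u u' v; ext i; simp only [Pi.add_apply]; ring)
    (by intro c u v; ext i; simp only [Pi.smul_apply, smul_eq_mul]; ring)
    (by intro u v v'; ext i; simp only [Pi.add_apply]; ring)
    (by intro c u v; ext i; simp only [Pi.smul_apply, smul_eq_mul]; ring)

section

variable {F : Type*} [Field F]

def A1 (α₁ α₂ α₄ β₁ : F) : Matrix (Fin 2) (Fin 4) F :=
  !![α₁, α₂, α₂ + 1, α₄; β₁, -α₁, -α₁ + 1, -α₂]

def A2 (α₁ β₁ β₂ : F) : Matrix (Fin 2) (Fin 4) F :=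
  !![α₁, 0, 0, 1; β₁, β₂, 1 - α₁, 0]

def A3 (β₁ β₂ : F) : Matrix (Fin 2) (Fin 4) F :=
  !![0, 1, 1, 0; β₁, β₂, 1, -1]

def A4 (α₁ β₂ : F) : Matrix (Fin 2) (Fin 4) F :=
  !![α₁, 0, 0, 0; 0, β₂, 1 - α₁, 0]

def A5 (α₁ : F) : Matrix (Fin 2) (Fin 4) F :=
  !![α₁, 0, 0, 0; 1, 2 * α₁ - 1, 1 - α₁, 0]

def A10 : Matrix (Fin 2) (Fin 4) F :=
  !![0, 1, 1, 0; 0, 0, 0, -1]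

def A11 : Matrix (Fin 2) (Fin 4) F :=
  !![0, 1, 1, 0; 1, 0, 0, -1]

def A12 : Matrix (Fin 2) (Fin 4) F :=
  !![0, 0, 0, 0; 1, 0, 0, 0]

/-- The list of matrices of structure constants of the self-opposite algebras. -/
inductive Listed : Matrix (Fin 2) (Fin 4) F → Prop
  | a1 (α₁ α₂ : F) : Listed (A1 α₁ (-α₁) α₂ α₂)
  | a2 (α₁ β₁ : F) : Listed (A2 α₁ β₁ (1 - α₁))
  | a2' : Listed (A2 0 0 (-1))
  | a3 (β₁ : F) : Listed (A3 β₁ 1)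
  | a3' (β₁ : F) : Listed (A3 β₁ (-1))
  | a4 (α₁ : F) : Listed (A4 α₁ (1 - α₁))
  | a4' : Listed (A4 0 (-1))
  | a5 : Listed (A5 (2 / 3))
  | a5' : Listed (A5 0)
  | a10 : Listed A10
  | a11 : Listed A11
  | a12 : Listed A12

end

end TwoDimAlg

namespace TwoDimAlg

/-! ### Transport along isomorphisms and structure constants. -/

section Basic

variable {F A B C : Type*} [Field F] [AddCommGroup A] [Module F A] [AddCommGroup B] [Module F B]
  [AddCommGroup C] [Module F C]

/-! When `3` is invertible, a product on a plane amounts to two linear forms `p = tr L`, `q = tr R`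
and the binary cubic `det (v, v·v)`: the eight structure constants split as 2 + 2 + 4, compatibly
with base change up to a determinant twist on the cubic (`algIso_ofMSC_iff`). Passing to the
opposite swaps `p` and `q` and fixes the cubic, so self-opposite means that some substitution swaps
the forms and preserves the twisted cubic.

If `p`, `q` are independent, they serve as coordinates; the substitution is the coordinate swap and
the cubic is antisymmetric under the twist (`A1`). If they are dependent and `q ≠ 0`, then `p = ±q`;
with `q = x`, the cubic is reduced by substitutions fixing `x`, and its degree in `y` selects `A2`,
`A3`, `A4` or `A5`. If `q = 0`, then `p = 0`, and the root multiplicities of the cubic select `A10`,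
`A11` or `A12`. Comparing these normal forms (`NormalForm.eq_or_of_rel`) leaves only the sign change
in `A2`. -/

theorem AlgIso.symm {μ : A →ₗ[F] A →ₗ[F] A} {ν : B →ₗ[F] B →ₗ[F] B} (h : AlgIso μ ν) :
    AlgIso ν μ := by
  obtain ⟨f, hf⟩ := h
  refine ⟨f.symm, fun u v => ?_⟩
  rw [LinearEquiv.symm_apply_eq, hf]
  simp

theorem AlgIso.trans {μ : A →ₗ[F] A →ₗ[F] A} {ν : B →ₗ[F] B →ₗ[F] B} {ρ : C →ₗ[F] C →ₗ[F] C}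
    (h : AlgIso μ ν) (h' : AlgIso ν ρ) : AlgIso μ ρ := by
  obtain ⟨f, hf⟩ := h
  obtain ⟨g, hg⟩ := h'
  exact ⟨f.trans g, fun u v => by simp [hf, hg]⟩

theorem AlgIso.flip {μ : A →ₗ[F] A →ₗ[F] A} {ν : B →ₗ[F] B →ₗ[F] B} (h : AlgIso μ ν) :
    AlgIso μ.flip ν.flip := by
  obtain ⟨f, hf⟩ := h
  exact ⟨f, fun u v => by simp [hf]⟩

theorem AlgIso.ne_zero {μ : A →ₗ[F] A →ₗ[F] A} {ν : B →ₗ[F] B →ₗ[F] B} (h : AlgIso μ ν)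
    (hμ : μ ≠ 0) : ν ≠ 0 := by
  obtain ⟨f, hf⟩ := h
  rintro rfl
  refine hμ (LinearMap.ext fun u => LinearMap.ext fun v => f.injective ?_)
  simp [hf]

theorem ofMSC_apply (M : Matrix (Fin 2) (Fin 4) F) (u v : Fin 2 → F) (i : Fin 2) :
    ofMSC M u v i = M i 0 * (u 0 * v 0) + M i 1 * (u 0 * v 1) + M i 2 * (u 1 * v 0)
      + M i 3 * (u 1 * v 1) := rfl

theorem ofMSC_zero : ofMSC (0 : Matrix (Fin 2) (Fin 4) F) = 0 := by
  ext; simp [ofMSC_apply]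

theorem ofMSC_ne_zero {M : Matrix (Fin 2) (Fin 4) F} (hM : M ≠ 0) : ofMSC M ≠ 0 := by
  intro h
  apply hM
  have key : ∀ u v i, ofMSC M u v i = 0 := fun u v i => by rw [h]; rfl
  simp only [ofMSC_apply] at key
  ext i j
  have h0 := key ![1, 0] ![1, 0] i
  have h1 := key ![1, 0] ![0, 1] i
  have h2 := key ![0, 1] ![1, 0] i
  have h3 := key ![0, 1] ![0, 1] i
  simp at h0 h1 h2 h3
  fin_cases j <;> simp_all

theorem exists_algIso_ofMSC (μ : A →ₗ[F] A →ₗ[F] A) (hA : Module.finrank F A = 2) :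
    ∃ M : Matrix (Fin 2) (Fin 4) F, AlgIso μ (ofMSC M) := by
  have : FiniteDimensional F A := Module.finite_of_finrank_pos (by omega)
  let b := Module.finBasisOfFinrankEq F A hA
  refine ⟨Matrix.of fun i => ![b.repr (μ (b 0) (b 0)) i, b.repr (μ (b 0) (b 1)) i,
    b.repr (μ (b 1) (b 0)) i, b.repr (μ (b 1) (b 1)) i], b.equivFun, fun u v => ?_⟩
  ext i
  rw [ofMSC_apply]
  have hu := b.sum_repr u
  have hv := b.sum_repr v
  rw [Fin.sum_univ_two] at hu hv
  conv_lhs => rw [← hu, ← hv]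
  simp
  ring

end Basic

/-! ### Traces and cubic as coordinates on structure constants. -/

/-- The two trace forms `p = tr ∘ L` and `q = tr ∘ R` of a two-dimensional algebra and the
coefficients of its binary cubic form `v ↦ det (v, v · v)`. -/
@[ext]
structure TraceCubic (F : Type*) where
  p₀ : F
  p₁ : F
  q₀ : F
  q₁ : F
  c₀ : F
  c₁ : F
  c₂ : F
  c₃ : F

namespace TraceCubic

variable {F : Type*} [Field F]

/-- The invariants of the algebra with matrix of structure constants `M`. -/
def ofMatrix (M : Matrix (Fin 2) (Fin 4) F) : TraceCubic F where
  p₀ := M 0 0 + M 1 1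
  p₁ := M 0 2 + M 1 3
  q₀ := M 0 0 + M 1 2
  q₁ := M 0 1 + M 1 3
  c₀ := M 1 0
  c₁ := M 1 1 + M 1 2 - M 0 0
  c₂ := M 1 3 - M 0 1 - M 0 2
  c₃ := -M 0 3

/-- The matrix of structure constants with given invariants. -/
def toMatrix (D : TraceCubic F) : Matrix (Fin 2) (Fin 4) F :=
  !![(D.p₀ + D.q₀ - D.c₁) / 3, D.q₁ - (D.p₁ + D.q₁ + D.c₂) / 3,
      D.p₁ - (D.p₁ + D.q₁ + D.c₂) / 3, -D.c₃;
    D.c₀, D.p₀ - (D.p₀ + D.q₀ - D.c₁) / 3, D.q₀ - (D.p₀ + D.q₀ - D.c₁) / 3,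
      (D.p₁ + D.q₁ + D.c₂) / 3]

theorem ofMatrix_toMatrix (h3 : (3 : F) ≠ 0) (D : TraceCubic F) : ofMatrix D.toMatrix = D := by
  ext <;> simp [ofMatrix, toMatrix] <;> field_simp <;> ring

theorem toMatrix_ofMatrix (h3 : (3 : F) ≠ 0) (M : Matrix (Fin 2) (Fin 4) F) :
    (ofMatrix M).toMatrix = M := by
  ext i j
  fin_cases i <;> fin_cases j <;> simp [ofMatrix, toMatrix] <;> field_simp <;> ring

/-- The invariants of the opposite algebra. -/
def swap (D : TraceCubic F) : TraceCubic F :=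
  ⟨D.q₀, D.q₁, D.p₀, D.p₁, D.c₀, D.c₁, D.c₂, D.c₃⟩

/-- `D` is obtained from `E` by the linear substitution with matrix `!![a, b; c, d]`. -/
structure IsPullback (D E : TraceCubic F) (a b c d : F) : Prop where
  det_ne : a * d - b * c ≠ 0
  p₀ : D.p₀ = E.p₀ * a + E.p₁ * c
  p₁ : D.p₁ = E.p₀ * b + E.p₁ * d
  q₀ : D.q₀ = E.q₀ * a + E.q₁ * c
  q₁ : D.q₁ = E.q₀ * b + E.q₁ * d
  c₀ : (a * d - b * c) * D.c₀ =
    E.c₀ * a ^ 3 + E.c₁ * (a ^ 2 * c) + E.c₂ * (a * c ^ 2) + E.c₃ * c ^ 3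
  c₁ : (a * d - b * c) * D.c₁ =
    E.c₀ * (3 * a ^ 2 * b) + E.c₁ * (a ^ 2 * d + 2 * a * b * c)
      + E.c₂ * (b * c ^ 2 + 2 * a * c * d) + E.c₃ * (3 * c ^ 2 * d)
  c₂ : (a * d - b * c) * D.c₂ =
    E.c₀ * (3 * a * b ^ 2) + E.c₁ * (b ^ 2 * c + 2 * a * b * d)
      + E.c₂ * (a * d ^ 2 + 2 * b * c * d) + E.c₃ * (3 * c * d ^ 2)
  c₃ : (a * d - b * c) * D.c₃ =
    E.c₀ * b ^ 3 + E.c₁ * (b ^ 2 * d) + E.c₂ * (b * d ^ 2) + E.c₃ * d ^ 3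

/-- Two systems of invariants are equivalent if they differ by a linear change of coordinates. -/
def Rel (D E : TraceCubic F) : Prop := ∃ a b c d : F, IsPullback D E a b c d

/-- The substitution with matrix `!![a, b; c, d]` applied to `E`. -/
def pull (E : TraceCubic F) (a b c d : F) : TraceCubic F where
  p₀ := E.p₀ * a + E.p₁ * c
  p₁ := E.p₀ * b + E.p₁ * d
  q₀ := E.q₀ * a + E.q₁ * c
  q₁ := E.q₀ * b + E.q₁ * d
  c₀ := (E.c₀ * a ^ 3 + E.c₁ * (a ^ 2 * c) + E.c₂ * (a * c ^ 2) + E.c₃ * c ^ 3) /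
    (a * d - b * c)
  c₁ := (E.c₀ * (3 * a ^ 2 * b) + E.c₁ * (a ^ 2 * d + 2 * a * b * c)
      + E.c₂ * (b * c ^ 2 + 2 * a * c * d) + E.c₃ * (3 * c ^ 2 * d)) / (a * d - b * c)
  c₂ := (E.c₀ * (3 * a * b ^ 2) + E.c₁ * (b ^ 2 * c + 2 * a * b * d)
      + E.c₂ * (a * d ^ 2 + 2 * b * c * d) + E.c₃ * (3 * c * d ^ 2)) / (a * d - b * c)
  c₃ := (E.c₀ * b ^ 3 + E.c₁ * (b ^ 2 * d) + E.c₂ * (b * d ^ 2) + E.c₃ * d ^ 3) /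
    (a * d - b * c)

theorem isPullback_pull (E : TraceCubic F) {a b c d : F} (h : a * d - b * c ≠ 0) :
    IsPullback (E.pull a b c d) E a b c d := by
  constructor <;> first | exact h | rfl | exact mul_div_cancel₀ _ h

theorem rel_pull (E : TraceCubic F) {a b c d : F} (h : a * d - b * c ≠ 0) :
    Rel (E.pull a b c d) E := ⟨a, b, c, d, isPullback_pull E h⟩

end TraceCubic

open TraceCubic

variable {F : Type*} [Field F]

/-! ### Isomorphism expressed through invariants. -/

theorem ofMSC_flip (M : Matrix (Fin 2) (Fin 4) F) :
    (ofMSC M).flip = ofMSC (M.submatrix id ![0, 2, 1, 3]) := by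
  refine LinearMap.ext fun u => LinearMap.ext fun v => ?_
  ext i
  rw [LinearMap.flip_apply]
  simp [ofMSC_apply]
  ring

theorem ofMatrix_submatrix (M : Matrix (Fin 2) (Fin 4) F) :
    ofMatrix (M.submatrix id ![0, 2, 1, 3]) = (ofMatrix M).swap := by
  ext <;> simp [ofMatrix, swap] <;> ring

theorem rel_of_algIso {M N : Matrix (Fin 2) (Fin 4) F} (h : AlgIso (ofMSC M) (ofMSC N)) :
    Rel (ofMatrix M) (ofMatrix N) := by
  obtain ⟨f, hf⟩ := h
  have hlin : ∀ u i, f u i = u 0 * f ![1, 0] i + u 1 * f ![0, 1] i := by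
    intro u i
    have : u = u 0 • ![1, 0] + u 1 • ![0, 1] := by
      ext j; fin_cases j <;> simp
    conv_lhs => rw [this, map_add, map_smul, map_smul]
    rfl
  have hdet : f ![1, 0] 0 * f ![0, 1] 1 - f ![0, 1] 0 * f ![1, 0] 1 ≠ 0 := by
    intro h0
    -- The columns of the adjugate are sent to multiples of the determinant, hence to zero.
    have h1 : f ![f ![0, 1] 1, - f ![1, 0] 1] = 0 := by
      ext i
      rw [hlin]
      fin_cases i
      · simp; linear_combination h0
      · simp; ring
    have h2 : f ![f ![0, 1] 0, - f ![1, 0] 0] = 0 := by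
      ext i
      rw [hlin]
      fin_cases i
      · simp; ring
      · simp; linear_combination -h0
    rw [map_eq_zero_iff f f.injective] at h1 h2
    have h3 := congrFun h1 1
    have h4 := congrFun h2 1
    simp at h3 h4
    have h5 : f ![1, 0] = 0 := by ext i; fin_cases i <;> simp [h3, h4]
    rw [map_eq_zero_iff f f.injective] at h5
    simpa using congrFun h5 0
  have e00 := fun i => congrFun (hf ![1, 0] ![1, 0]) i
  have e01 := fun i => congrFun (hf ![1, 0] ![0, 1]) i
  have e10 := fun i => congrFun (hf ![0, 1] ![1, 0]) i
  have e11 := fun i => congrFun (hf ![0, 1] ![0, 1]) i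
  simp only [hlin (ofMSC M _ _)] at e00 e01 e10 e11
  simp [ofMSC_apply] at e00 e01 e10 e11
  obtain ⟨u0, u1⟩ := e00
  obtain ⟨v0, v1⟩ := e01
  obtain ⟨w0, w1⟩ := e10
  obtain ⟨x0, x1⟩ := e11
  generalize f ![1, 0] 0 = a, f ![0, 1] 0 = b, f ![1, 0] 1 = c, f ![0, 1] 1 = d at *
  -- After scaling by the determinant, Cramer's rule recovers the structure constants of `M` from
  -- the images of the basis products.
  refine ⟨a, b, c, d, hdet, mul_left_cancel₀ hdet ?_, mul_left_cancel₀ hdet ?_,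
    mul_left_cancel₀ hdet ?_, mul_left_cancel₀ hdet ?_, ?_, ?_, ?_, ?_⟩ <;>
    simp only [ofMatrix]
  · linear_combination d * u0 - b * u1 + a * v1 - c * v0
  · linear_combination d * w0 - b * w1 + a * x1 - c * x0
  · linear_combination d * u0 - b * u1 + a * w1 - c * w0
  · linear_combination d * v0 - b * v1 + a * x1 - c * x0
  · linear_combination a * u1 - c * u0
  · linear_combination a * v1 - c * v0 + a * w1 - c * w0 - d * u0 + b * u1
  · linear_combination a * x1 - c * x0 - d * v0 + b * v1 - d * w0 + b * w1
  · linear_combination -d * x0 + b * x1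

theorem algIso_of_rel (h3 : (3 : F) ≠ 0) {M N : Matrix (Fin 2) (Fin 4) F}
    (h : Rel (ofMatrix M) (ofMatrix N)) : AlgIso (ofMSC M) (ofMSC N) := by
  obtain ⟨a, b, c, d, h⟩ := h
  have hdet := h.det_ne
  obtain ⟨-, p0, p1, q0, q1, r0, r1, r2, r3⟩ := h
  simp only [ofMatrix] at p0 p1 q0 q1 r0 r1 r2 r3
  have scale : ∀ {x y : F}, x = y → (a * d - b * c) * x = (a * d - b * c) * y :=
    fun h => congrArg _ h
  -- These are the inversion formulas of `toMatrix` with the denominators `3` and the determinant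
  -- cleared.
  have m00 := congr (congrArg HSub.hSub (congr (congrArg HAdd.hAdd (scale p0)) (scale q0))) r1
  have m13 := congr (congrArg HAdd.hAdd (congr (congrArg HAdd.hAdd (scale p1)) (scale q1))) r2
  have m10 := congrArg (3 * ·) r0
  have m03 := congrArg (-3 * ·) r3
  have m11 := congr (congrArg HSub.hSub (congrArg (3 * ·) (scale p0))) m00
  have m12 := congr (congrArg HSub.hSub (congrArg (3 * ·) (scale q0))) m00
  have m02 := congr (congrArg HSub.hSub (congrArg (3 * ·) (scale p1))) m13
  have m01 := congr (congrArg HSub.hSub (congrArg (3 * ·) (scale q1))) m13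
  let f : (Fin 2 → F) ≃ₗ[F] (Fin 2 → F) :=
    { toFun := fun u => ![a * u 0 + b * u 1, c * u 0 + d * u 1]
      invFun := fun u => ![(d * u 0 - b * u 1) / (a * d - b * c),
        (a * u 1 - c * u 0) / (a * d - b * c)]
      map_add' := by intro u v; ext i; fin_cases i <;> simp <;> ring
      map_smul' := by intro u v; ext i; fin_cases i <;> simp <;> ring
      left_inv := by
        intro u; ext i; fin_cases i <;> simp <;> rw [div_eq_iff hdet] <;> ring
      right_inv := by
        intro u; ext i
        have h1 := mul_inv_cancel₀ hdet
        fin_cases i <;> simp [div_eq_mul_inv]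
        · linear_combination u 0 * h1
        · linear_combination u 1 * h1 }
  refine ⟨f, fun u v => ?_⟩
  ext i
  fin_cases i <;> simp [f, ofMSC_apply]
  all_goals apply mul_left_cancel₀ (mul_ne_zero h3 hdet)
  · linear_combination a * (u 0 * v 0 * m00 + u 0 * v 1 * m01 + u 1 * v 0 * m02 + u 1 * v 1 * m03)
      + b * (u 0 * v 0 * m10 + u 0 * v 1 * m11 + u 1 * v 0 * m12 + u 1 * v 1 * m13)
  · linear_combination c * (u 0 * v 0 * m00 + u 0 * v 1 * m01 + u 1 * v 0 * m02 + u 1 * v 1 * m03)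
      + d * (u 0 * v 0 * m10 + u 0 * v 1 * m11 + u 1 * v 0 * m12 + u 1 * v 1 * m13)

theorem algIso_ofMSC_iff (h3 : (3 : F) ≠ 0) {M N : Matrix (Fin 2) (Fin 4) F} :
    AlgIso (ofMSC M) (ofMSC N) ↔ Rel (ofMatrix M) (ofMatrix N) :=
  ⟨rel_of_algIso, algIso_of_rel h3⟩

theorem algIso_flip_iff (h3 : (3 : F) ≠ 0) {M : Matrix (Fin 2) (Fin 4) F} :
    AlgIso (ofMSC M).flip (ofMSC M) ↔ Rel (ofMatrix M).swap (ofMatrix M) := by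
  rw [ofMSC_flip, algIso_ofMSC_iff h3, ofMatrix_submatrix]

namespace TraceCubic

/-- Every system of invariants comes from an algebra, so symmetry is inherited from `AlgIso` without
inverting substitutions by hand. -/
theorem Rel.symm (h3 : (3 : F) ≠ 0) {D E : TraceCubic F} (h : Rel D E) : Rel E D := by
  rw [← ofMatrix_toMatrix h3 D, ← ofMatrix_toMatrix h3 E] at h ⊢
  exact rel_of_algIso (algIso_of_rel h3 h).symm

theorem Rel.trans (h3 : (3 : F) ≠ 0) {D E G : TraceCubic F} (h : Rel D E) (h' : Rel E G) :
    Rel D G := by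
  rw [← ofMatrix_toMatrix h3 D, ← ofMatrix_toMatrix h3 E] at h
  rw [← ofMatrix_toMatrix h3 E, ← ofMatrix_toMatrix h3 G] at h'
  rw [← ofMatrix_toMatrix h3 D, ← ofMatrix_toMatrix h3 G]
  exact rel_of_algIso ((algIso_of_rel h3 h).trans (algIso_of_rel h3 h'))

theorem Rel.swap {D E : TraceCubic F} (h : Rel D E) : Rel D.swap E.swap := by
  obtain ⟨a, b, c, d, h⟩ := h
  exact ⟨a, b, c, d, h.det_ne, h.q₀, h.q₁, h.p₀, h.p₁, h.c₀, h.c₁, h.c₂, h.c₃⟩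

/-- Invariants of algebras isomorphic to their opposite. -/
def SelfOpposite (D : TraceCubic F) : Prop := Rel D.swap D

theorem SelfOpposite.of_rel (h3 : (3 : F) ≠ 0) {D E : TraceCubic F} (hE : SelfOpposite E)
    (h : Rel D E) : SelfOpposite D :=
  (h.swap.trans h3 hE).trans h3 (h.symm h3)

/-- Invariants of algebras isomorphic to a listed one. -/
def Good (D : TraceCubic F) : Prop := ∃ N, Listed N ∧ Rel (ofMatrix N) D

theorem Good.of_rel (h3 : (3 : F) ≠ 0) {D E : TraceCubic F} (hD : Good D) (h : Rel D E) :
    Good E := by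
  obtain ⟨N, hN, hND⟩ := hD
  exact ⟨N, hN, hND.trans h3 h⟩

/-! ### Reduction of self-opposite invariants to the list. -/

theorem rel_refl (D : TraceCubic F) : Rel D D :=
  ⟨1, 0, 0, 1, by constructor <;> simp⟩

theorem good_of_eq {D : TraceCubic F} {N : Matrix (Fin 2) (Fin 4) F} (hN : Listed N)
    (h : ofMatrix N = D) : Good D := ⟨N, hN, h ▸ rel_refl _⟩

/-- Self-opposite invariants with linearly independent traces. -/
theorem good_of_independent (h3 : (3 : F) ≠ 0) {E : TraceCubic F} (hE : SelfOpposite E)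
    (h : E.p₀ * E.q₁ - E.p₁ * E.q₀ ≠ 0) : Good E := by
  -- This substitution makes `q` the first coordinate and `p` the second.
  have hdet : (-E.p₁ / (E.p₀ * E.q₁ - E.p₁ * E.q₀)) * (-E.q₀ / (E.p₀ * E.q₁ - E.p₁ * E.q₀))
      - (E.q₁ / (E.p₀ * E.q₁ - E.p₁ * E.q₀)) * (E.p₀ / (E.p₀ * E.q₁ - E.p₁ * E.q₀)) ≠ 0 := by
    intro h0
    field_simp at h0
    apply h
    linear_combination -h0
  refine Good.of_rel h3 ?_ (rel_pull E hdet)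
  have hD := hE.of_rel h3 (rel_pull E hdet)
  generalize hDE : E.pull _ _ _ _ = D at hD
  have hp₀ : D.p₀ = 0 := by rw [← hDE]; simp only [pull]; ring
  have hp₁ : D.p₁ = 1 := by
    rw [← hDE]; simp only [pull]; rw [← div_self h]; ring
  have hq₀ : D.q₀ = 1 := by
    rw [← hDE]; simp only [pull]; rw [← div_self h]; ring
  have hq₁ : D.q₁ = 0 := by rw [← hDE]; simp only [pull]; ring
  obtain ⟨a, b, c, d, H⟩ := hD
  obtain ⟨p₀, p₁, q₀, q₁, c₀, c₁, c₂, c₃⟩ := D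
  obtain ⟨-, r₁, r₂, r₃, r₄, e₀, e₁, e₂, e₃⟩ := H
  simp only at hp₀ hp₁ hq₀ hq₁
  subst hp₀ hp₁ hq₀ hq₁
  simp [TraceCubic.swap] at r₁ r₂ r₃ r₄ e₀ e₁ e₂ e₃
  -- The substitution is now the coordinate swap, of determinant `-1`, whence `c₃ = -c₀` and `c₂ =
  -- -c₁`.
  subst r₁ r₂ r₃ r₄
  simp at e₀ e₁
  refine good_of_eq (Listed.a1 ((1 - c₁) / 3) c₀) ?_
  ext <;> simp [ofMatrix, A1]
  · field_simp; ring
  · field_simp; linear_combination 3 * e₁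
  · exact e₀

/-- Normal form of the cubic under substitutions fixing the first coordinate function. -/
theorem exists_shear_normal_form
    (hsqrt : ∀ t : F, ∃ x : F, x ^ 2 = t) (h2 : (2 : F) ≠ 0) (h3 : (3 : F) ≠ 0)
    (e t c₀ c₁ c₂ c₃ : F) :
    (∃ β s, Rel ⟨e, 0, 1, 0, β, s, 0, -1⟩ ⟨e, 0, 1, 0, c₀, c₁, c₂, c₃⟩) ∨
    (∃ β, Rel ⟨e, 0, 1, 0, β, t, -3, 0⟩ ⟨e, 0, 1, 0, c₀, c₁, c₂, c₃⟩) ∨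
    (∃ s, Rel ⟨e, 0, 1, 0, 0, s, 0, 0⟩ ⟨e, 0, 1, 0, c₀, c₁, c₂, c₃⟩) ∨
    Rel ⟨e, 0, 1, 0, 1, 0, 0, 0⟩ ⟨e, 0, 1, 0, c₀, c₁, c₂, c₃⟩ := by
  by_cases hc₃ : c₃ = 0
  · subst hc₃
    by_cases hc₂ : c₂ = 0
    · subst hc₂
      by_cases hc₁ : c₁ = 0
      · subst hc₁
        by_cases hc₀ : c₀ = 0
        · subst hc₀
          exact Or.inr (Or.inr (Or.inl ⟨0, rel_refl _⟩))
        · refine Or.inr (Or.inr (Or.inr ⟨1, 0, 0, c₀, ?_⟩))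
          constructor <;> simp [hc₀]
      · refine Or.inr (Or.inr (Or.inl ⟨c₁, 1, 0, -c₀ / c₁, 1, ?_⟩))
        constructor <;> simp
        field_simp; ring
    · refine Or.inr (Or.inl ⟨_, 1, 0, (t - c₁) / (2 * c₂), -3 / c₂, ?_, ?_, ?_, ?_, ?_,
        (mul_div_cancel₀ _ ?_), ?_, ?_, ?_⟩) <;> simp [hc₂, h3] <;>
        field_simp <;> ring
  -- Under `y ↦ c x + d y` the determinant is `d`, so `c₃` is multiplied by `d ^ 2`; the shear then
  -- removes the `x y²` term.
  · obtain ⟨d, hd⟩ := hsqrt (-1 / c₃)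
    have hd0 : d ≠ 0 := by
      rintro rfl
      field_simp at hd
      simp at hd
    have hd' : c₃ * d ^ 2 = -1 := by rw [hd]; field_simp
    refine Or.inl ⟨_, _, 1, 0, -c₂ / (3 * c₃), d, ?_, ?_, ?_, ?_, ?_,
        (mul_div_cancel₀ _ ?_), (mul_div_cancel₀ _ ?_), ?_, ?_⟩ <;> simp [hd0]
    · field_simp; ring
    · linear_combination -d * hd'

/-- Self-opposite invariants with dependent traces, the second being the first coordinate. -/
theorem good_of_dependent
    (hsqrt : ∀ t : F, ∃ x : F, x ^ 2 = t) (h2 : (2 : F) ≠ 0) (h3 : (3 : F) ≠ 0)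
    {e c₀ c₁ c₂ c₃ : F} (h : SelfOpposite ⟨e, 0, 1, 0, c₀, c₁, c₂, c₃⟩) :
    Good ⟨e, 0, 1, 0, c₀, c₁, c₂, c₃⟩ := by
  have he : e = 1 ∨ e = -1 := by
    obtain ⟨a, b, c, d, -, r₁, -, r₃, -⟩ := h
    simp [TraceCubic.swap] at r₁ r₃
    subst r₃
    exact mul_self_eq_one_iff.mp r₁.symm
  -- The value `1 + e` is the `x²y` coefficient of the cubic of `A3 β e`.
  rcases exists_shear_normal_form hsqrt h2 h3 e (1 + e) c₀ c₁ c₂ c₃ with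
    ⟨β, s, hr⟩ | ⟨β, hr⟩ | ⟨s, hr⟩ | hr <;>
    refine Good.of_rel h3 ?_ hr <;> replace h := h.of_rel h3 hr <;> clear hr <;>
    rcases he with rfl | rfl
  · refine good_of_eq (Listed.a2 ((2 - s) / 3) β) ?_
    ext <;> simp [ofMatrix, A2]
    field_simp; ring
  · obtain ⟨a, b, c, d, r⟩ := h
    obtain ⟨r₀, r₁, r₂, r₃, r₄, r₅, r₆, r₇, r₈⟩ := r
    simp [TraceCubic.swap] at r₀ r₁ r₂ r₃ r₄ r₅ r₆ r₇ r₈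
    subst r₃ r₄
    -- Here `a = -1` and `b = 0`; the cubic forces `d² = -1` and `c = 0`, then `2s = 0` and `β (d -
    -- 1) = 0`, where `d ≠ 1`.
    have hβ : β = 0 ∧ s = 0 := by
      simp at r₀ r₅ r₆ r₇ r₈
      grind
    obtain ⟨rfl, rfl⟩ := hβ
    refine good_of_eq Listed.a2' ?_
    ext <;> simp [ofMatrix, A2]
  · refine good_of_eq (Listed.a3 β) ?_
    ext <;> simp [ofMatrix, A3]
    norm_num
  · refine good_of_eq (Listed.a3' β) ?_
    ext <;> simp [ofMatrix, A3]
    norm_num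
  · refine good_of_eq (Listed.a4 ((2 - s) / 3)) ?_
    ext <;> simp [ofMatrix, A4]
    field_simp; ring
  · obtain ⟨a, b, c, d, r⟩ := h
    obtain ⟨r₀, r₁, r₂, r₃, r₄, r₅, r₆, r₇, r₈⟩ := r
    simp [TraceCubic.swap] at r₀ r₁ r₂ r₃ r₄ r₅ r₆ r₇ r₈
    subst r₃ r₄
    have hs : s = 0 := by
      simp at r₀ r₅ r₆
      grind
    subst hs
    refine good_of_eq Listed.a4' ?_
    ext <;> simp [ofMatrix, A4]
  · refine good_of_eq Listed.a5 ?_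
    ext <;> simp [ofMatrix, A5] <;> field_simp <;> ring
  · refine good_of_eq Listed.a5' ?_
    ext <;> simp [ofMatrix, A5]

/-- Cubics divisible by the first coordinate, with vanishing traces. -/
theorem good_of_traceless_aux
    (hsqrt : ∀ t : F, ∃ x : F, x ^ 2 = t) (h2 : (2 : F) ≠ 0) (h3 : (3 : F) ≠ 0)
    {c₀ c₁ c₂ : F} (h : ¬ (c₀ = 0 ∧ c₁ = 0 ∧ c₂ = 0)) :
    Good ⟨0, 0, 0, 0, c₀, c₁, c₂, 0⟩ := by
  have g10 : Good (⟨0, 0, 0, 0, 0, 0, -3, 0⟩ : TraceCubic F) :=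
    good_of_eq Listed.a10 (by ext <;> simp [ofMatrix, A10]; norm_num)
  have g11 : Good (⟨0, 0, 0, 0, 1, 0, -3, 0⟩ : TraceCubic F) :=
    good_of_eq Listed.a11 (by ext <;> simp [ofMatrix, A11]; norm_num)
  have g12 : Good (⟨0, 0, 0, 0, 1, 0, 0, 0⟩ : TraceCubic F) :=
    good_of_eq Listed.a12 (by ext <;> simp [ofMatrix, A12])
  by_cases hc₂ : c₂ = 0
  · subst hc₂
    by_cases hc₁ : c₁ = 0
    · subst hc₁
      have hc₀ : c₀ ≠ 0 := by simpa using h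
      refine g12.of_rel h3 ⟨1, 0, 0, c₀, ?_⟩
      constructor <;> simp [hc₀]
    · refine g10.of_rel h3 ⟨0, 3 / c₁, 1, -c₀ * (3 / c₁) / c₁, ?_⟩
      constructor <;> simp [hc₁, h3] <;> field_simp <;> ring
  -- Up to sign, this is the discriminant of the quadratic cofactor of `x`. Completing the square
  -- gives the shear, and `a` below normalises the `x³` coefficient to `1`.
  · by_cases hc₀ : 4 * c₀ * c₂ - c₁ ^ 2 = 0
    · refine g10.of_rel h3 ⟨1, 0, -c₁ / (2 * c₂), -3 / c₂, ?_⟩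
      constructor <;> simp [hc₂, h3] <;> field_simp
      · linear_combination -hc₀
      · ring
    · obtain ⟨a, ha⟩ := hsqrt (-12 / (4 * c₀ * c₂ - c₁ ^ 2))
      have h12 : (12 : F) ≠ 0 := by
        have : (12 : F) = 2 * 2 * 3 := by norm_num
        rw [this]; simp [h2, h3]
      have ha' : (4 * c₀ * c₂ - c₁ ^ 2) * a ^ 2 = -12 := by rw [ha]; field_simp
      have ha0 : a ≠ 0 := by rintro rfl; apply h12; linear_combination ha'
      refine g11.of_rel h3 ⟨a, 0, -c₁ * a / (2 * c₂), -3 / c₂, ?_⟩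
      constructor <;> simp [hc₂, h3, ha0] <;> field_simp
      · linear_combination -ha'
      · ring

theorem good_of_traceless
    (hroot : ∀ p : Polynomial F, p.natDegree = 2 ∨ p.natDegree = 3 → ∃ x : F, p.IsRoot x)
    (hsqrt : ∀ t : F, ∃ x : F, x ^ 2 = t) (h2 : (2 : F) ≠ 0) (h3 : (3 : F) ≠ 0)
    {c₀ c₁ c₂ c₃ : F} (h : ¬ (c₀ = 0 ∧ c₁ = 0 ∧ c₂ = 0 ∧ c₃ = 0)) :
    Good ⟨0, 0, 0, 0, c₀, c₁, c₂, c₃⟩ := by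
  by_cases hc₃ : c₃ = 0
  · subst hc₃
    exact good_of_traceless_aux hsqrt h2 h3 (by simpa using h)
  obtain ⟨y, hy⟩ := hroot (Polynomial.C c₃ * Polynomial.X ^ 3 + Polynomial.C c₂ * Polynomial.X ^ 2
    + Polynomial.C c₁ * Polynomial.X + Polynomial.C c₀) (Or.inr (Polynomial.natDegree_cubic hc₃))
  simp at hy
  -- The second basis vector goes to the zero `(1, y)` of the cubic, which kills the new `c₃`.
  have hr := rel_pull (⟨0, 0, 0, 0, c₀, c₁, c₂, c₃⟩ : TraceCubic F)
    (a := 0) (b := 1) (c := 1) (d := y) (by simp)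
  refine Good.of_rel h3 ?_ hr
  have h0 : c₀ + c₁ * y + c₂ * y ^ 2 + c₃ * y ^ 3 = 0 := by linear_combination hy
  simp [pull, h0]
  exact good_of_traceless_aux hsqrt h2 h3 (by simp [hc₃])

/-- Every nonzero system of self-opposite invariants belongs to a listed algebra. -/
theorem SelfOpposite.good
    (hroot : ∀ p : Polynomial F, p.natDegree = 2 ∨ p.natDegree = 3 → ∃ x : F, p.IsRoot x)
    (hsqrt : ∀ t : F, ∃ x : F, x ^ 2 = t) (h2 : (2 : F) ≠ 0) (h3 : (3 : F) ≠ 0)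
    {E : TraceCubic F} (hE : SelfOpposite E) (h0 : E ≠ ⟨0, 0, 0, 0, 0, 0, 0, 0⟩) : Good E := by
  by_cases hq : E.q₀ = 0 ∧ E.q₁ = 0
  · obtain ⟨a, b, c, d, H⟩ := id hE
    -- The form `p` is a pullback of `q`, so it vanishes too.
    have hp₀ := H.q₀
    have hp₁ := H.q₁
    simp [TraceCubic.swap, hq] at hp₀ hp₁
    obtain ⟨p₀, p₁, q₀, q₁, c₀, c₁, c₂, c₃⟩ := E
    simp only at hq hp₀ hp₁
    obtain ⟨rfl, rfl⟩ := hq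
    subst hp₀ hp₁
    exact good_of_traceless hroot hsqrt h2 h3 (by simpa using h0)
  have key : ∃ D : TraceCubic F, D.q₀ = 1 ∧ D.q₁ = 0 ∧ Rel D E := by
    by_cases hq₀ : E.q₀ = 0
    · have hq₁ : E.q₁ ≠ 0 := fun h => hq ⟨hq₀, h⟩
      refine ⟨_, ?_, ?_, rel_pull E (a := 0) (b := 1) (c := 1 / E.q₁) (d := 0) ?_⟩ <;>
        simp [pull, hq₀, hq₁]
    · refine ⟨_, ?_, ?_, rel_pull E (a := 1 / E.q₀) (b := -E.q₁) (c := 0) (d := E.q₀) ?_⟩ <;>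
        simp [pull, hq₀]
      ring
  obtain ⟨D, hq₀, hq₁, hr⟩ := key
  refine Good.of_rel h3 ?_ hr
  have hD := hE.of_rel h3 hr
  obtain ⟨p₀, p₁, q₀, q₁, c₀, c₁, c₂, c₃⟩ := D
  simp only at hq₀ hq₁
  subst hq₀ hq₁
  by_cases hp₁ : p₁ = 0
  · subst hp₁
    exact good_of_dependent hsqrt h2 h3 hD
  · exact good_of_independent h3 hD (by simp [hp₁])

end TraceCubic

/-! ### Listed algebras are nontrivial and self-opposite. -/

theorem Listed.ne_zero {M : Matrix (Fin 2) (Fin 4) F} (hM : Listed M) : M ≠ 0 := by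
  intro h
  have key : ∀ i j, M i j = 0 := fun i j => by rw [h]; rfl
  rcases hM with ⟨α, β⟩ | ⟨α, β⟩ | _ | β | β | α | _ | _ | _ | _ | _ | _
  · have h₁ := key 0 1
    have h₂ := key 0 2
    simp [A1] at h₁ h₂
    simp [h₁] at h₂
  · simpa [A2] using key 0 3
  · simpa [A2] using key 0 3
  · simpa [A3] using key 0 1
  · simpa [A3] using key 0 1
  · have h₁ := key 0 0
    have h₂ := key 1 2
    simp [A4] at h₁ h₂
    simp [h₁] at h₂
  · simpa [A4] using key 1 2
  · simpa [A5] using key 1 0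
  · simpa [A5] using key 1 0
  · simpa [A10] using key 0 1
  · simpa [A11] using key 0 1
  · simpa [A12] using key 1 0

theorem Listed.selfOpposite (hsqrt : ∀ t : F, ∃ x : F, x ^ 2 = t) (h3 : (3 : F) ≠ 0)
    {M : Matrix (Fin 2) (Fin 4) F} (hM : Listed M) : SelfOpposite (ofMatrix M) := by
  -- Equal traces mean a commutative product.
  have comm : ∀ D : TraceCubic F, D.p₀ = D.q₀ → D.p₁ = D.q₁ → SelfOpposite D := by
    intro D h h'
    refine ⟨1, 0, 0, 1, ?_⟩
    constructor <;> simp [TraceCubic.swap, h, h']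
  rcases hM with ⟨α, β⟩ | ⟨α, β⟩ | _ | β | β | α | _ | _ | _ | _ | _ | _
  · refine ⟨0, 1, 1, 0, ?_⟩
    constructor <;> simp [TraceCubic.swap, ofMatrix, A1] <;> ring
  · apply comm <;> simp [ofMatrix, A2]
  · obtain ⟨i, hi⟩ := hsqrt (-1)
    have hi0 : i ≠ 0 := by rintro rfl; simp at hi
    refine ⟨-1, 0, 0, i, ?_⟩
    constructor <;> simp [TraceCubic.swap, ofMatrix, A2, hi0]
    linear_combination i * hi
  · apply comm <;> simp [ofMatrix, A3]
  · refine ⟨-1, 0, 0, 1, ?_⟩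
    constructor <;> simp [TraceCubic.swap, ofMatrix, A3]
    ring
  · apply comm <;> simp [ofMatrix, A4]
  · refine ⟨-1, 0, 0, 1, ?_⟩
    constructor <;> simp [TraceCubic.swap, ofMatrix, A4]
  · apply comm <;> simp [ofMatrix, A5]
    field_simp
    ring
  · refine ⟨-1, 0, 0, 1, ?_⟩
    constructor <;> simp [TraceCubic.swap, ofMatrix, A5]
    ring
  · apply comm <;> simp [ofMatrix, A10]
  · apply comm <;> simp [ofMatrix, A11]
  · apply comm <;> simp [ofMatrix, A12]

/-! ### Isomorphisms within the list. -/

/-- Normal forms of the invariants of listed algebras. -/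
inductive NormalForm : TraceCubic F → Prop
  | independent (β s : F) : NormalForm ⟨0, 1, 1, 0, β, s, -s, -β⟩
  | cubic (e β s : F) : NormalForm ⟨e, 0, 1, 0, β, s, 0, -1⟩
  | quadratic (e β : F) : NormalForm ⟨e, 0, 1, 0, β, 1 + e, -3, 0⟩
  | linear (e s : F) : NormalForm ⟨e, 0, 1, 0, 0, s, 0, 0⟩
  | constant (e : F) : NormalForm ⟨e, 0, 1, 0, 1, 0, 0, 0⟩
  | doubleRoot : NormalForm ⟨0, 0, 0, 0, 0, 0, -3, 0⟩
  | distinctRoots : NormalForm ⟨0, 0, 0, 0, 1, 0, -3, 0⟩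
  | tripleRoot : NormalForm ⟨0, 0, 0, 0, 1, 0, 0, 0⟩

theorem Listed.normalForm (h3 : (3 : F) ≠ 0) {M : Matrix (Fin 2) (Fin 4) F} (hM : Listed M) :
    NormalForm (ofMatrix M) := by
  rcases hM with ⟨α, β⟩ | ⟨α, β⟩ | _ | β | β | α | _ | _ | _ | _ | _ | _
  · convert NormalForm.independent β (1 - 3 * α) using 1
    ext <;> simp [ofMatrix, A1] <;> ring
  · convert NormalForm.cubic 1 β (2 - 3 * α) using 1
    ext <;> simp [ofMatrix, A2]
    ring
  · convert NormalForm.cubic (-1 : F) 0 0 using 1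
    ext <;> simp [ofMatrix, A2]
  · convert NormalForm.quadratic 1 β using 1
    ext <;> simp [ofMatrix, A3]
    ring
  · convert NormalForm.quadratic (-1) β using 1
    ext <;> simp [ofMatrix, A3]
    ring
  · convert NormalForm.linear 1 (2 - 3 * α) using 1
    ext <;> simp [ofMatrix, A4]
    ring
  · convert NormalForm.linear (-1 : F) 0 using 1
    ext <;> simp [ofMatrix, A4]
  · convert NormalForm.constant (1 : F) using 1
    ext <;> simp [ofMatrix, A5] <;> field_simp <;> ring
  · convert NormalForm.constant (-1 : F) using 1
    ext <;> simp [ofMatrix, A5]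
  · convert NormalForm.doubleRoot (F := F) using 1
    ext <;> simp [ofMatrix, A10]
    ring
  · convert NormalForm.distinctRoots (F := F) using 1
    ext <;> simp [ofMatrix, A11]
    ring
  · convert NormalForm.tripleRoot (F := F) using 1
    ext <;> simp [ofMatrix, A12]

theorem NormalForm.eq_or_of_rel (h2 : (2 : F) ≠ 0) (h3 : (3 : F) ≠ 0) {D E : TraceCubic F}
    (hD : NormalForm D) (hE : NormalForm E) (h : Rel D E) :
    D = E ∨ ∃ e β s : F, D = ⟨e, 0, 1, 0, β, s, 0, -1⟩ ∧ E = ⟨e, 0, 1, 0, -β, s, 0, -1⟩ := by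
  obtain ⟨a, b, c, d, r₀, r₁, r₂, r₃, r₄, r₅, r₆, r₇, r₈⟩ := h
  cases hD <;> cases hE <;> simp at r₀ r₁ r₂ r₃ r₄ r₅ r₆ r₇ r₈
  all_goals first
    | (exfalso; grind)
    | (left; ext <;> simp <;> grind)
    | skip
  case cubic.cubic β' s' e β s =>
    subst r₃ r₄
    have hd : d ≠ 0 := fun h => r₀ (by rw [h]; ring)
    have hd1 : d * d = 1 := mul_left_cancel₀ hd (by linear_combination r₈)
    have hc : c = 0 := by
      have : 3 * c = 0 := by linear_combination r₇ - 3 * c * hd1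
      simpa [h3] using this
    subst hc
    have hs : s' = s := mul_left_cancel₀ hd (by linear_combination r₆)
    have he := r₁.trans (mul_one _)
    subst hs he
    rcases mul_self_eq_one_iff.mp hd1 with rfl | rfl
    · left
      congr 1
      linear_combination r₅
    · refine Or.inr ⟨_, β', s', rfl, ?_⟩
      congr 1
      linear_combination -r₅
  case quadratic.quadratic β' e β =>
    subst r₃ r₄
    have hd : d ≠ 0 := fun h => r₀ (by rw [h]; ring)
    have hd1 : d = 1 := mul_left_cancel₀ (mul_ne_zero h3 hd) (by linear_combination r₇)
    have he := r₁.trans (mul_one _)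
    subst hd1 he
    have hc : c = 0 := by
      have : 2 * 3 * c = 0 := by linear_combination r₆
      simpa [h2, h3] using this
    subst hc
    left
    congr 1
    linear_combination r₅
  -- The first basis vector is a double zero of `xy²`, so `(a, c)` would be a double zero of `x³ -
  -- 3xy²`, which has none.
  case doubleRoot.distinctRoots =>
    exfalso
    have ha : a ≠ 0 := by
      rintro rfl
      have hbc : 3 * (b * c ^ 2) = 0 := by linear_combination r₆
      rcases mul_eq_zero.mp ((mul_eq_zero.mp hbc).resolve_left h3) with h | h
      · exact r₀ (by rw [h]; ring)
      · exact r₀ (by rw [pow_eq_zero_iff two_ne_zero |>.mp h]; ring)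
    have ha2 : a ^ 2 = 3 * c ^ 2 := mul_left_cancel₀ ha (by linear_combination -r₅)
    have hc : c ≠ 0 := by
      rintro rfl
      exact ha (by simpa using ha2)
    refine r₀ (mul_left_cancel₀ (mul_ne_zero (mul_ne_zero h2 h3) hc) ?_)
    linear_combination r₆ + 3 * b * ha2

/-- Only the `A2` entries have this shape. It confines the sign change of `β` to the family with `p
= q`; elsewhere it is trivial. -/
theorem Listed.traces_or {M : Matrix (Fin 2) (Fin 4) F}
    (hM : Listed M) {e β s : F} (h : ofMatrix M = ⟨e, 0, 1, 0, β, s, 0, -1⟩) :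
    e = 1 ∨ β = 0 := by
  rcases hM with ⟨α, β⟩ | ⟨α, β⟩ | _ | β | β | α | _ | _ | _ | _ | _ | _ <;>
    simp [ofMatrix, A1, A2, A3, A4, A5, A10, A11, A12] at h
  · exact Or.inl h.1.symm
  · exact Or.inr h.2.1.symm

theorem ne_zero_and_algIso_flip_iff
    (hroot : ∀ p : Polynomial F, p.natDegree = 2 ∨ p.natDegree = 3 → ∃ x : F, p.IsRoot x)
    (hsqrt : ∀ t : F, ∃ x : F, x ^ 2 = t) (h2 : (2 : F) ≠ 0) (h3 : (3 : F) ≠ 0)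
    {A : Type*} [AddCommGroup A] [Module F A] (μ : A →ₗ[F] A →ₗ[F] A)
    (hA : Module.finrank F A = 2) :
    (μ ≠ 0 ∧ AlgIso μ.flip μ) ↔
      ∃ M : Matrix (Fin 2) (Fin 4) F, Listed M ∧ AlgIso μ (ofMSC M) := by
  constructor
  · rintro ⟨hμ, hself⟩
    obtain ⟨M, hM⟩ := exists_algIso_ofMSC μ hA
    have hM0 := hM.ne_zero hμ
    have hD : SelfOpposite (ofMatrix M) :=
      (algIso_flip_iff h3).mp ((hM.flip.symm.trans hself).trans hM)
    obtain ⟨N, hN, hr⟩ := hD.good hroot hsqrt h2 h3 (by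
      intro h
      apply hM0
      rw [← toMatrix_ofMatrix h3 M, h, ← ofMSC_zero]
      congr 1
      ext i j
      fin_cases i <;> fin_cases j <;> simp [toMatrix])
    exact ⟨N, hN, hM.trans (algIso_of_rel h3 hr).symm⟩
  · rintro ⟨N, hN, h⟩
    refine ⟨h.symm.ne_zero (ofMSC_ne_zero hN.ne_zero), ?_⟩
    exact (h.flip.trans ((algIso_flip_iff h3).mpr (hN.selfOpposite hsqrt h3))).trans h.symm

theorem Listed.algIso_iff (h2 : (2 : F) ≠ 0) (h3 : (3 : F) ≠ 0)
    {M N : Matrix (Fin 2) (Fin 4) F} (hM : Listed M) (hN : Listed N) :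
    AlgIso (ofMSC M) (ofMSC N) ↔
      M = N ∨ ∃ α₁ β₁ : F, M = A2 α₁ β₁ (1 - α₁) ∧ N = A2 α₁ (-β₁) (1 - α₁) := by
  have inj : ∀ {K L : Matrix (Fin 2) (Fin 4) F}, ofMatrix K = ofMatrix L → K = L := by
    intro K L h
    rw [← toMatrix_ofMatrix h3 K, h, toMatrix_ofMatrix h3]
  rw [algIso_ofMSC_iff h3]
  constructor
  · intro h
    rcases (hM.normalForm h3).eq_or_of_rel h2 h3 (hN.normalForm h3) h with
      h | ⟨e, β, s, hD, hE⟩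
    · exact Or.inl (inj h)
    rcases hM.traces_or hD with rfl | rfl
    · refine Or.inr ⟨(2 - s) / 3, β, inj ?_, inj ?_⟩
      · rw [hD]
        ext <;> simp [ofMatrix, A2]
        field_simp; ring
      · rw [hE]
        ext <;> simp [ofMatrix, A2]
        field_simp; ring
    · rw [neg_zero] at hE
      exact Or.inl (inj (hD.trans hE.symm))
  · rintro (rfl | ⟨α, β, rfl, rfl⟩)
    · exact rel_refl _
    · refine ⟨1, 0, 0, -1, ?_⟩
      constructor <;> simp [ofMatrix, A2]
      norm_num

end TwoDimAlg

theorem mainTheorem6 {F : Type*} [Field F]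
    (hroot : ∀ p : Polynomial F, p.natDegree = 2 ∨ p.natDegree = 3 → ∃ x : F, p.IsRoot x)
    (h2 : ringChar F ≠ 2) (h3 : ringChar F ≠ 3) :
    -- the nontrivial self-opposite algebras are, up to isomorphism, exactly those on the list
    (∀ (A : Type*) [AddCommGroup A] [Module F A] (μ : A →ₗ[F] A →ₗ[F] A),
      Module.finrank F A = 2 →
        ((μ ≠ 0 ∧ TwoDimAlg.AlgIso μ.flip μ) ↔
          ∃ M : Matrix (Fin 2) (Fin 4) F,
            TwoDimAlg.Listed M ∧ TwoDimAlg.AlgIso μ (TwoDimAlg.ofMSC M))) ∧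
    -- the list repeats an isomorphism class only through `A₂(α₁, β₁, β₂) ≅ A₂(α₁, -β₁, β₂)`
    (∀ M N : Matrix (Fin 2) (Fin 4) F, TwoDimAlg.Listed M → TwoDimAlg.Listed N →
      (TwoDimAlg.AlgIso (TwoDimAlg.ofMSC M) (TwoDimAlg.ofMSC N) ↔
        M = N ∨ ∃ α₁ β₁ : F, M = TwoDimAlg.A2 α₁ β₁ (1 - α₁) ∧
          N = TwoDimAlg.A2 α₁ (-β₁) (1 - α₁))) := by
  have two_ne : (2 : F) ≠ 0 := Ring.two_ne_zero h2
  have three_ne : (3 : F) ≠ 0 := by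
    intro h
    have hdvd : ringChar F ∣ 3 := ringChar.dvd (by exact_mod_cast h)
    rcases (Nat.dvd_prime Nat.prime_three).mp hdvd with h1 | h1
    · exact CharP.ringChar_ne_one h1
    · exact h3 h1
  have hsqrt : ∀ t : F, ∃ x : F, x ^ 2 = t := by
    intro t
    obtain ⟨x, hx⟩ := hroot (Polynomial.X ^ 2 - Polynomial.C t)
      (Or.inl Polynomial.natDegree_X_pow_sub_C)
    exact ⟨x, by simpa [sub_eq_zero] using hx⟩
  exact ⟨fun A _ _ μ hA =>
      TwoDimAlg.ne_zero_and_algIso_flip_iff hroot hsqrt two_ne three_ne μ hA,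
    fun M N hM hN => TwoDimAlg.Listed.algIso_iff two_ne three_ne hM hN⟩
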